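/- **Setting.** A contextual POMDP has a finite context set $\mathcal C=\{1,\dots,N\}$, measurable state, action and observation spaces $\mathcal S,\mathcal A,\mathcal O$ (the $\sigma$-algebras of $\mathcal A$ and $\mathcal O$ countably generated), and for each context $c$ a transition kernel $P_c:\mathcal S\times\mathcal A\to\mathrm{Dist}(\mathcal S)$, an emission kernel $E_c:\mathcal S\to\mathrm{Dist}(\mathcal O)$, a measurable reward function $r_c$ with $|r_c|\le R_{\max}$ (where $R_{\max}>0$), and an initial state distribution $\mu_c$. A policy draws the action $A_t$ from a distribution that depends on $(O_{0:t},A_{0:t-1})$; $\Pi$ is a given class of policies. For the horizon $T$ let $V_c(\pi)=\mathbb E_{c,\pi}\big[\sum_{t=0}^{T-1}r_c(S_t,A_t)\big]$, and assume that for each $c$ there is $\pi_c^\star\in\arg\max_{\pi\in\Pi}V_c(\pi)$. The true context $C=c^\star$ is drawn once from a prior on $\mathcal C$ and stays fixed during $K$ episodes. In episode $k=1,\dots,K$ a policy $\pi_k$, which is a measurable function of the past $\mathcal H_{k-1}=(Y^1,\dots,Y^{k-1})$, is run in context $c^\star$, and the trajectory $Y^k=(O^k_{0:T},A^k_{0:T-1})$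 is observed. Put $\bar V_k(\pi)=\sum_{c}\mathbb P(C=c\mid\mathcal H_{k-1})\,V_c(\pi)$, and let $I_k(\pi)=I(C;Y^k\mid\mathcal H_{k-1},\pi)$ be the mutual information, in nats, between the context, distributed according to the current posterior $\mathbb P(C\in\cdot\mid\mathcal H_{k-1})$, and the trajectory observed when $\pi$ is run for one episode. Let $H(C\mid\mathcal H_{k-1})$ and $I(C;Y^k\mid\mathcal H_{k-1})=\mathbb E[I_k(\pi_k)]$ be the conditional entropy and the conditional mutual information (averaged over the past), and let $\eta>0$ be a constant such that $$H(C\mid\mathcal H_{k-1})\le\tfrac1\eta\,I(C;Y^k\mid\mathcal H_{k-1})\qquad(k=1,\dots,K).$$ **Theorem (Bayesian regret of entropy-regularized CPOMDP).** There are universal constants $\xi,\kappa>0$ such that the following holds. Let $\tau>0$ and suppose that, almost surely, in each episode $$\pi_k\in\arg\max_{\pi\in\Pi}\big(\bar V_k(\pi)+\tau I_k(\pi)\big).$$ Then the expected Bayesian regret after $K$ episodes satisfies $$\mathbb E[\mathrm{BR}(K,T)]:=\mathbb E\Big[\sum_{k=1}^K\big(V_{c^\star}(\pi^\star_{c^\star})-V_{c^\star}(\pi_k)\big)\Big]\le\tau\log|\mathcal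 C|+\xi\,T R_{\max}\sqrt{\frac{K\log|\mathcal C|}{\eta}}+2\,T R_{\max}\sqrt{KT}.$$ In particular, $\mathbb E[\mathrm{BR}(K,T)]=O\big(T R_{\max}\sqrt{K\log|\mathcal C|/\eta}\big)$ as $K\to\infty$: there is $K_0$ depending only on $\tau,T,R_{\max},|\mathcal C|$ such that $\mathbb E[\mathrm{BR}(K,T)]\le\kappa\,T R_{\max}\sqrt{K\log|\mathcal C|/\eta}$ whenever $K\ge K_0$. -/

import Mathlib

open MeasureTheory ProbabilityTheory

noncomputable section

namespace CPOMDP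

/-- A full trajectory `((S_t, O_t)_{0 ≤ t ≤ T}, (A_t)_{0 ≤ t < T})` of one episode. -/
abbrev Traj (S A O : Type*) (T : ℕ) : Type _ := (Fin (T + 1) → S × O) × (Fin T → A)

/-- The part `(O_{0:T}, A_{0:T-1})` of a trajectory that the agent observes. -/
abbrev ObsTraj (A O : Type*) (T : ℕ) : Type _ := (Fin (T + 1) → O) × (Fin T → A)

/-- Forget the hidden states. -/
def Traj.observed {S A O : Type*} {T : ℕ} (x : Traj S A O T) : ObsTraj A O T :=
  (fun t => (x.1 t).2, x.2)

/-- Append an action, the next hidden state and the next observation. -/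
def Traj.snoc {S A O : Type*} {T : ℕ} (x : (Traj S A O T × A) × (S × O)) : Traj S A O (T + 1) :=
  (Fin.snoc (α := fun _ => S × O) x.1.1.1 x.2, Fin.snoc (α := fun _ => A) x.1.1.2 x.1.2)

end CPOMDP

/-- A contextual POMDP with contexts `Fin N`, state space `S`, action space `A`, observation
space `O`. -/
structure CPOMDP (N : ℕ) (S A O : Type*) [MeasurableSpace S] [MeasurableSpace A]
    [MeasurableSpace O] where
  /-- transition kernels `P_c : S × A → Dist(S)` -/
  trans : Fin N → Kernel (S × A) S
  /-- emission kernels `E_c : S → Dist(O)` -/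
  emit : Fin N → Kernel S O
  /-- reward functions `r_c` -/
  reward : Fin N → S → A → ℝ
  /-- initial state distributions `μ_c` -/
  init : Fin N → Measure S
  trans_markov : ∀ c, IsMarkovKernel (trans c)
  emit_markov : ∀ c, IsMarkovKernel (emit c)
  reward_measurable : ∀ c, Measurable (fun p : S × A => reward c p.1 p.2)
  init_prob : ∀ c, IsProbabilityMeasure (init c)

namespace CPOMDP

attribute [instance] trans_markov emit_markov init_prob

/-- A randomized, history-dependent policy: at time `t` it draws `A_t` from a distribution that
depends on `(O_{0:t}, A_{0:t-1})`. -/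
structure Policy (A O : Type*) [MeasurableSpace A] [MeasurableSpace O] where
  act : ∀ t : ℕ, Kernel (ObsTraj A O t) A
  act_markov : ∀ t, IsMarkovKernel (act t)

attribute [instance] Policy.act_markov

section

variable {N : ℕ} {S A O : Type*} [MeasurableSpace S] [MeasurableSpace A] [MeasurableSpace O]

theorem measurable_observed {T : ℕ} :
    Measurable (Traj.observed : Traj S A O T → ObsTraj A O T) := by
  unfold Traj.observed
  fun_prop

theorem measurable_snoc {T : ℕ} :
    Measurable (Traj.snoc : (Traj S A O T × A) × (S × O) → Traj S A O (T + 1)) := by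
  refine Measurable.prodMk (measurable_pi_lambda _ fun i => ?_) (measurable_pi_lambda _ fun i => ?_)
  · refine Fin.lastCases ?_ (fun j => ?_) i
    · simpa using measurable_snd
    · simp only [Fin.snoc_castSucc]; fun_prop
  · refine Fin.lastCases ?_ (fun j => ?_) i
    · simp only [Fin.snoc_last]; fun_prop
    · simp only [Fin.snoc_castSucc]; fun_prop

/-- The current hidden state, together with the chosen action. -/
def Traj.last {T : ℕ} (x : Traj S A O T × A) : S × A := ((x.1.1 (Fin.last T)).1, x.2)

theorem measurable_last {T : ℕ} :
    Measurable (Traj.last : Traj S A O T × A → S × A) := by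
  unfold Traj.last
  fun_prop

/-- One step of the environment in context `c`: from `(s, a)` draw `s' ∼ P_c(s, a)`, then
`o' ∼ E_c(s')`. -/
def stepKernel (M : CPOMDP N S A O) (c : Fin N) : Kernel (S × A) (S × O) :=
  (M.trans c) ⊗ₖ ((M.emit c).comap Prod.snd measurable_snd)

instance (M : CPOMDP N S A O) (c : Fin N) : IsMarkovKernel (M.stepKernel c) := by
  unfold stepKernel
  infer_instance

/-- The law of the trajectory up to time `T` when policy `π` is run in context `c`:
`S_0 ∼ μ_c`, `O_t ∼ E_c(S_t)`, `A_t ∼ π(O_{0:t}, A_{0:t-1})`, `S_{t+1} ∼ P_c(S_t, A_t)`. -/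
def trajLaw (M : CPOMDP N S A O) (c : Fin N) (π : Policy A O) : (T : ℕ) → Measure (Traj S A O T)
  | 0 => (M.init c ⊗ₘ M.emit c).map (fun p => (fun _ => p, Fin.elim0))
  | T + 1 => ((M.trajLaw c π T ⊗ₘ (π.act T).comap Traj.observed measurable_observed) ⊗ₘ
      (M.stepKernel c).comap Traj.last measurable_last).map Traj.snoc

instance (M : CPOMDP N S A O) (c : Fin N) (π : Policy A O) (T : ℕ) :
    IsProbabilityMeasure (M.trajLaw c π T) := by
  induction T with
  | zero => exact Measure.isProbabilityMeasure_map (by fun_prop)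
  | succ T ih => exact Measure.isProbabilityMeasure_map measurable_snoc.aemeasurable

/-- The episodic value `V_c(π) = E_π[∑_{t=0}^{T-1} r_c(S_t, A_t)]`. -/
def value (M : CPOMDP N S A O) (T : ℕ) (c : Fin N) (π : Policy A O) : ℝ :=
  ∫ x, ∑ t : Fin T, M.reward c (x.1 t.castSucc).1 (x.2 t) ∂(M.trajLaw c π T)

/-- The law of the observed trajectory `Y` when `π` is run in context `c`. -/
def obsLaw (M : CPOMDP N S A O) (T : ℕ) (c : Fin N) (π : Policy A O) : Measure (ObsTraj A O T) :=
  (M.trajLaw c π T).map Traj.observed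

/-- `c ↦` law of the observed trajectory, as a kernel. -/
def obsKernel (M : CPOMDP N S A O) (T : ℕ) (π : Policy A O) : Kernel (Fin N) (ObsTraj A O T) :=
  ⟨fun c => M.obsLaw T c π, measurable_from_top⟩

/-- The expected value `E_{c ∼ b}[V_c(π)]` under a belief `b` about the context. -/
def expectedValue (M : CPOMDP N S A O) (T : ℕ) (b : Measure (Fin N)) (π : Policy A O) : ℝ :=
  ∫ c, M.value T c π ∂b

/-- The mutual information (in nats) of two random variables with joint law `ρ`. -/
def mutualInfo {α β : Type*} [MeasurableSpace α] [MeasurableSpace β] (ρ : Measure (α × β)) : ℝ :=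
  (InformationTheory.klDiv ρ (ρ.fst.prod ρ.snd)).toReal

/-- The mutual information of the context and the observed trajectory when the context has
distribution `b` and the policy `π` is run for one episode. -/
def infoGain (M : CPOMDP N S A O) (T : ℕ) (b : Measure (Fin N)) (π : Policy A O) : ℝ :=
  mutualInfo (b ⊗ₘ M.obsKernel T π)

/-- The Shannon entropy (in nats) of a distribution on the contexts. -/
def entropy (b : Measure (Fin N)) : ℝ := ∑ c, Real.negMulLog (b.real {c})

/-- The conditional law of the observed trajectory of an episode, given the context and the
past `h`, when the policy `sel h` is run. -/
def episodeKernel {H : Type*} [MeasurableSpace H] (M : CPOMDP N S A O) (T : ℕ)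
    (sel : H → Policy A O) (hsel : ∀ c, Measurable fun h => M.trajLaw c (sel h) T) :
    Kernel (Fin N × H) (ObsTraj A O T) :=
  ⟨fun p => M.obsLaw T p.1 (sel p.2), measurable_from_prod_countable_right fun c =>
    (Measure.measurable_map _ measurable_observed).comp (hsel c)⟩

end

/-- `K` episodes of horizon `T` in the contextual POMDP `M`, on a probability space `(Ω, P)`. The
context is drawn once from the prior and then kept; episodes are numbered from `0`; in episode `k`
the policy `sel k h` is run in the true context, where `h` is the list of the trajectories observed
in the episodes before `k`. -/
structure Interaction {N : ℕ} {S A O Ω : Type*} [MeasurableSpace S] [MeasurableSpace A]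
    [MeasurableSpace O] [MeasurableSpace Ω] (M : CPOMDP N S A O) (T K : ℕ)
    (prior : Measure (Fin N)) (P : Measure Ω) where
  /-- the true context -/
  ctx : Ω → Fin N
  /-- the trajectory observed in episode `k` -/
  obs : ℕ → Ω → ObsTraj A O T
  /-- the policy selected in episode `k` on the basis of the past -/
  sel : ∀ k : ℕ, (Fin k → ObsTraj A O T) → Policy A O
  ctx_measurable : Measurable ctx
  obs_measurable : ∀ k, Measurable (obs k)
  /-- The selection is measurable: what it does depends measurably on the past. -/
  sel_measurable : ∀ k c, Measurable fun h => M.trajLaw c (sel k h) T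
  ctx_law : P.map ctx = prior
  /-- Given the context `c` and the past `h`, the observed trajectory of episode `k` is distributed
  as that of the policy `sel k h` in context `c`. -/
  obs_law : ∀ k < K,
    P.map (fun ω => ((ctx ω, fun i : Fin k => obs i ω), obs k ω)) =
      P.map (fun ω => (ctx ω, fun i : Fin k => obs i ω)) ⊗ₘ
        M.episodeKernel T (sel k) (sel_measurable k)

namespace Interaction

variable {N : ℕ} [NeZero N] {S A O Ω : Type*} [MeasurableSpace S] [MeasurableSpace A]
  [MeasurableSpace O] [MeasurableSpace Ω] {M : CPOMDP N S A O} {T K : ℕ}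
  {prior : Measure (Fin N)} {P : Measure Ω} [IsProbabilityMeasure P]

/-- The past of episode `k`: the trajectories observed in the episodes `0, …, k - 1`. -/
def hist (X : Interaction M T K prior P) (k : ℕ) (ω : Ω) : Fin k → ObsTraj A O T :=
  fun i => X.obs i ω

/-- The policy that is run in episode `k`. -/
def policy (X : Interaction M T K prior P) (k : ℕ) (ω : Ω) : Policy A O := X.sel k (X.hist k ω)

/-- The posterior distribution of the context at the beginning of episode `k`. -/
def posterior (X : Interaction M T K prior P) (k : ℕ) (ω : Ω) : Measure (Fin N) :=
  condDistrib X.ctx (X.hist k) P (X.hist k ω)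

/-- In every episode the policy maximizes, over the policy class `Pol`, the posterior-expected value
plus `τ` times the information gain about the context. -/
def IsCIDS (X : Interaction M T K prior P) (Pol : Set (Policy A O)) (τ : ℝ) : Prop :=
  ∀ k < K, ∀ᵐ ω ∂P, X.policy k ω ∈ Pol ∧
    IsMaxOn (fun π => M.expectedValue T (X.posterior k ω) π + τ * M.infoGain T (X.posterior k ω) π)
      Pol (X.policy k ω)

/-- The conditional entropy of the context given the past of episode `k`. -/
def condEntropy (X : Interaction M T K prior P) (k : ℕ) : ℝ :=
  ∫ ω, entropy (X.posterior k ω) ∂P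

/-- The conditional mutual information of the context and the trajectory observed in episode `k`,
given the past of episode `k`. -/
def condMutualInfo (X : Interaction M T K prior P) (k : ℕ) : ℝ :=
  ∫ ω, M.infoGain T (X.posterior k ω) (X.policy k ω) ∂P

/-- `η > 0` is a constant that relates the remaining uncertainty about the context to the
information gained in an episode: `H(C | past) ≤ I(C; Y^k | past) / η` in each of the `K`
episodes. -/
def IsInfoConstant (X : Interaction M T K prior P) (η : ℝ) : Prop :=
  0 < η ∧ ∀ k < K, X.condEntropy k ≤ 1 / η * X.condMutualInfo k

/-- The Bayesian regret after `K` episodes with respect to the policies `πstar c` (which are to be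
optimal for the contexts `c`). -/
def regret (X : Interaction M T K prior P) (πstar : Fin N → Policy A O) (ω : Ω) : ℝ :=
  ∑ k ∈ Finset.range K,
    (M.value T (X.ctx ω) (πstar (X.ctx ω)) - M.value T (X.ctx ω) (X.policy k ω))

end Interaction

end CPOMDP

end

/-!
Given the past, the expected information gain of an episode equals the expected decrease of the
posterior entropy of the context, so the information gains telescope to at most the entropy of the
prior. Comparing the chosen policy with the one that is optimal for the most probable context `i`
bounds the conditional expected regret of the episode by `2 T Rmax · P(C ≠ i) + τ I_k`, and
`P(C ≠ i) ≤ min(1, H)` for the posterior entropy `H`, because `-log x ≥ 1 - x`. With `H_k` the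
conditional entropy before episode `k`, both `∑ min(1, H_k) ≤ K` and
`∑ min(1, H_k) ≤ ∑ H_k ≤ H(C) / η`, whence `∑ min(1, H_k) ≤ √(K H(C) / η)`. The first episode
forces `η ≤ 1` unless `H(C) = 0`, so for large `K` the term `τ H(C)` is absorbed in the root.
-/

namespace CPOMDP

section CountablyGenerated

open MeasurableSpace

theorem countablyGenerated_iSup {ι α : Type*} [Countable ι] {m : ι → MeasurableSpace α}
    (h : ∀ i, @CountablyGenerated α (m i)) : @CountablyGenerated α (⨆ i, m i) := by
  choose b hb hm using fun i => (h i).isCountablyGenerated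
  refine @CountablyGenerated.mk _ (⨆ i, m i) ⟨⋃ i, b i, Set.countable_iUnion hb, ?_⟩
  rw [← iSup_generateFrom]
  exact iSup_congr hm

instance countablyGenerated_pi {ι : Type*} [Countable ι] {α : ι → Type*}
    [∀ i, MeasurableSpace (α i)] [∀ i, CountablyGenerated (α i)] :
    CountablyGenerated (∀ i, α i) :=
  countablyGenerated_iSup fun i => CountablyGenerated.comap fun x : ∀ i, α i => x i

end CountablyGenerated

section KullbackLeibler

open InformationTheory

variable {α β : Type*} [MeasurableSpace α] [MeasurableSpace β]

theorem rnDeriv_compProd_right [MeasurableSpace.CountableOrCountablyGenerated α β]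
    {μ : Measure α} [IsFiniteMeasure μ] {κ η : Kernel α β} [IsFiniteKernel κ] [IsFiniteKernel η]
    (h : ∀ᵐ a ∂μ, κ a ≪ η a) :
    (μ ⊗ₘ κ).rnDeriv (μ ⊗ₘ η) =ᵐ[μ ⊗ₘ η] fun p => κ.rnDeriv η p.1 p.2 := by
  have hκ : μ ⊗ₘ κ = (μ ⊗ₘ η).withDensity fun p => κ.rnDeriv η p.1 p.2 := by
    rw [← Measure.compProd_withDensity (Kernel.measurable_rnDeriv κ η)]
    refine Measure.compProd_congr ?_
    filter_upwards [h] with a ha using (Kernel.withDensity_rnDeriv_eq ha).symm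
  rw [hκ]
  exact Measure.rnDeriv_withDensity _ (Kernel.measurable_rnDeriv κ η)

theorem klDiv_compProd_right [MeasurableSpace.CountableOrCountablyGenerated α β]
    {μ : Measure α} [IsFiniteMeasure μ] {κ η : Kernel α β} [IsFiniteKernel κ] [IsFiniteKernel η]
    (h : ∀ᵐ a ∂μ, κ a ≪ η a) :
    klDiv (μ ⊗ₘ κ) (μ ⊗ₘ η) = ∫⁻ a, klDiv (κ a) (η a) ∂μ :=
  calc klDiv (μ ⊗ₘ κ) (μ ⊗ₘ η)
      = ∫⁻ p, ENNReal.ofReal (klFun (κ.rnDeriv η p.1 p.2).toReal) ∂(μ ⊗ₘ η) := by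
        rw [klDiv_eq_lintegral_klFun_of_ac (Measure.AbsolutelyContinuous.compProd_right h)]
        refine lintegral_congr_ae ?_
        filter_upwards [rnDeriv_compProd_right h] with p hp
        rw [hp]
    _ = ∫⁻ a, ∫⁻ b, ENNReal.ofReal (klFun (κ.rnDeriv η a b).toReal) ∂η a ∂μ :=
        Measure.lintegral_compProd (by fun_prop)
    _ = ∫⁻ a, klDiv (κ a) (η a) ∂μ := by
        refine lintegral_congr_ae ?_
        filter_upwards [h] with a ha
        rw [klDiv_eq_lintegral_klFun_of_ac ha]
        refine lintegral_congr_ae ?_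
        filter_upwards [Kernel.rnDeriv_eq_rnDeriv_measure (κ := κ) (η := η) (a := a)] with b hb
        rw [hb]

theorem rnDeriv_singleton_mul [MeasurableSingletonClass α] {μ ν : Measure α} [SFinite ν]
    [μ.HaveLebesgueDecomposition ν] (h : μ ≪ ν) (a : α) :
    μ.rnDeriv ν a * ν {a} = μ {a} := by
  rw [← lintegral_singleton, Measure.setLIntegral_rnDeriv h]

theorem ae_absolutelyContinuous_comp [Countable β] [MeasurableSingletonClass β] (μ : Measure α)
    (κ : Kernel α β) : ∀ᵐ a ∂μ, κ a ≪ κ ∘ₘ μ := by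
  have hnull : ∀ b, ∀ᵐ a ∂μ, (κ ∘ₘ μ) {b} = 0 → κ a {b} = 0 := fun b => by
    by_cases hb : (κ ∘ₘ μ) {b} = 0
    · rw [Measure.bind_apply (measurableSet_singleton b) κ.aemeasurable,
        lintegral_eq_zero_iff (κ.measurable_coe (measurableSet_singleton b))] at hb
      filter_upwards [hb] with a ha _ using ha
    · exact Filter.Eventually.of_forall fun a h => absurd h hb
  filter_upwards [ae_all_iff.2 hnull] with a ha s hs
  rw [← Set.biUnion_of_singleton s, measure_biUnion_null_iff s.to_countable] at hs ⊢
  exact fun b hb => ha b (hs b hb)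

theorem klDiv_map_measurableEquiv (e : α ≃ᵐ β) (μ ν : Measure α) [IsFiniteMeasure μ]
    [IsFiniteMeasure ν] : klDiv (μ.map e) (ν.map e) = klDiv μ ν := by
  refine le_antisymm (klDiv_map_le μ ν e.measurable) ?_
  simpa only [Measure.map_map e.symm.measurable e.measurable, e.symm_comp_self, Measure.map_id]
    using klDiv_map_le (μ.map e) (ν.map e) e.symm.measurable

theorem mutualInfo_map_swap (ρ : Measure (α × β)) [IsFiniteMeasure ρ] :
    mutualInfo (ρ.map Prod.swap) = mutualInfo ρ := by
  rw [mutualInfo, Measure.fst_map_swap, Measure.snd_map_swap, ← Measure.prod_swap]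
  exact congrArg ENNReal.toReal (klDiv_map_measurableEquiv MeasurableEquiv.prodComm ρ _)

theorem integrable_integral_comp {μ : Measure α} [SFinite μ] {κ : Kernel α β} [IsSFiniteKernel κ]
    {f : β → ℝ} (hf : Integrable f (κ ∘ₘ μ)) : Integrable (fun a => ∫ b, f b ∂κ a) μ := by
  rw [Measure.comp_eq_comp_const_apply] at hf
  simpa only [Kernel.const_apply] using hf.integral_comp

theorem integral_comp_measure {μ : Measure α} [SFinite μ] {κ : Kernel α β} [IsSFiniteKernel κ]
    {f : β → ℝ} (hf : Integrable f (κ ∘ₘ μ)) : ∫ b, f b ∂(κ ∘ₘ μ) = ∫ a, ∫ b, f b ∂κ a ∂μ := by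
  rw [Measure.comp_eq_comp_const_apply] at hf ⊢
  rw [Kernel.integral_comp hf, Kernel.const_apply]

theorem integrable_integral_compProd {μ : Measure α} [SFinite μ] {m : Kernel α β}
    [IsSFiniteKernel m] {f : α × β → ℝ} (hf : Integrable f (μ ⊗ₘ m)) :
    Integrable (fun x => ∫ y, f (x, y) ∂m x) μ := by
  rw [Measure.compProd] at hf
  simpa only [Kernel.const_apply, Kernel.prodMkLeft_apply] using hf.integral_compProd

end KullbackLeibler

section Entropy

open InformationTheory

variable {N : ℕ}

theorem integral_log_real_singleton (b : Measure (Fin N)) [IsFiniteMeasure b] :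
    ∫ c, Real.log (b.real {c}) ∂b = -entropy b := by
  simp only [integral_fintype Integrable.of_finite, entropy, Real.negMulLog, smul_eq_mul, neg_mul,
    Finset.sum_neg_distrib, neg_neg]

theorem sum_real_singleton_eq_one (b : Measure (Fin N)) [IsProbabilityMeasure b] :
    ∑ c, b.real {c} = 1 := by
  rw [sum_measureReal_singleton, Finset.coe_univ, probReal_univ]

theorem entropy_nonneg (b : Measure (Fin N)) [IsZeroOrProbabilityMeasure b] : 0 ≤ entropy b :=
  Finset.sum_nonneg fun _ _ => Real.negMulLog_nonneg measureReal_nonneg measureReal_le_one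

theorem toReal_klDiv_eq_neg_entropy_sub (μ ν : Measure (Fin N)) [IsProbabilityMeasure μ]
    [IsProbabilityMeasure ν] (h : μ ≪ ν) :
    (klDiv μ ν).toReal = -entropy μ - ∫ c, Real.log (ν.real {c}) ∂μ := by
  have hllr : llr μ ν =ᵐ[μ] fun c => Real.log (μ.real {c}) - Real.log (ν.real {c}) := by
    rw [Filter.EventuallyEq, ae_iff_of_countable]
    intro c hc
    have hνc : ν.real {c} ≠ 0 := by
      rw [measureReal_ne_zero_iff]
      exact fun h0 => hc (h h0)
    have hμc : μ.real {c} ≠ 0 := by rwa [measureReal_ne_zero_iff]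
    rw [← Real.log_div hμc hνc, llr, Measure.real, Measure.real, ← rnDeriv_singleton_mul h c,
      ENNReal.toReal_mul, ← Measure.real, mul_div_cancel_right₀ _ hνc]
  rw [toReal_klDiv_of_measure_eq h (by simp only [measure_univ]), integral_congr_ae hllr,
    integral_sub Integrable.of_finite Integrable.of_finite, integral_log_real_singleton]

theorem measurable_entropy {α : Type*} [MeasurableSpace α] (κ : Kernel α (Fin N)) :
    Measurable fun a => entropy (κ a) :=
  Finset.measurable_sum _ fun c _ => Real.continuous_negMulLog.measurable.comp
    (κ.measurable_coe (measurableSet_singleton c)).ennreal_toReal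

theorem entropy_le_log (b : Measure (Fin N)) [IsProbabilityMeasure b] :
    entropy b ≤ Real.log N := by
  have hN : (N : ℝ) ≠ 0 := by
    obtain ⟨c⟩ := nonempty_of_isProbabilityMeasure b
    exact_mod_cast c.pos.ne'
  have hjensen := Real.concaveOn_negMulLog.le_map_sum (t := Finset.univ)
    (w := fun _ : Fin N => (N : ℝ)⁻¹) (p := fun c => b.real {c}) (fun _ _ => by positivity)
    (by simp [hN]) (fun _ _ => measureReal_nonneg)
  simp only [smul_eq_mul, ← Finset.mul_sum, sum_real_singleton_eq_one, mul_one] at hjensen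
  refine le_of_mul_le_mul_left (a := (N : ℝ)⁻¹) ?_ (by positivity)
  simpa only [entropy, Real.negMulLog, Real.log_inv, neg_mul_neg] using hjensen

theorem integrable_entropy {α : Type*} [MeasurableSpace α] (κ : Kernel α (Fin N))
    [IsMarkovKernel κ] (μ : Measure α) [IsFiniteMeasure μ] :
    Integrable (fun a => entropy (κ a)) μ :=
  Integrable.of_mem_Icc 0 (Real.log N) (measurable_entropy κ).aemeasurable
    (Filter.Eventually.of_forall fun _ => ⟨entropy_nonneg _, entropy_le_log _⟩)

theorem mutualInfo_compProd {α : Type*} [MeasurableSpace α] (μ : Measure α)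
    [IsProbabilityMeasure μ] (κ : Kernel α (Fin N)) [IsMarkovKernel κ] :
    mutualInfo (μ ⊗ₘ κ) = entropy (κ ∘ₘ μ) - ∫ a, entropy (κ a) ∂μ := by
  set b := κ ∘ₘ μ with hb
  have hac : ∀ᵐ a ∂μ, κ a ≪ b := ae_absolutelyContinuous_comp μ κ
  have hlog : Integrable (fun c => Real.log (b.real {c})) b := Integrable.of_finite
  have hlogκ : Integrable (fun a => ∫ c, Real.log (b.real {c}) ∂κ a) μ :=
    integrable_integral_comp hlog
  have hentropy : Integrable (fun a => -entropy (κ a)) μ := (integrable_entropy κ μ).neg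
  have hkl : ∀ᵐ a ∂μ, (klDiv (κ a) b).toReal =
      -entropy (κ a) - ∫ c, Real.log (b.real {c}) ∂κ a := by
    filter_upwards [hac] with a ha using toReal_klDiv_eq_neg_entropy_sub _ _ ha
  have htop : ∀ᵐ a ∂μ, klDiv (κ a) b ≠ ⊤ := by
    filter_upwards [hac] with a ha using klDiv_ne_top ha Integrable.of_finite
  have hmeas : AEMeasurable (fun a => klDiv (κ a) b) μ := by
    refine (hentropy.sub hlogκ).aemeasurable.ennreal_ofReal.congr ?_
    filter_upwards [hkl, htop] with a ha hat
    rw [Pi.sub_apply, ← ha, ENNReal.ofReal_toReal hat]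
  calc mutualInfo (μ ⊗ₘ κ)
      = (∫⁻ a, klDiv (κ a) b ∂μ).toReal := by
        rw [mutualInfo, Measure.fst_compProd, Measure.snd_compProd, ← Measure.compProd_const,
          klDiv_compProd_right hac]
        rfl
    _ = ∫ a, (klDiv (κ a) b).toReal ∂μ :=
        (integral_toReal hmeas (htop.mono fun _ ha => ha.lt_top)).symm
    _ = ∫ a, (-entropy (κ a) - ∫ c, Real.log (b.real {c}) ∂κ a) ∂μ := integral_congr_ae hkl
    _ = entropy b - ∫ a, entropy (κ a) ∂μ := by
        rw [integral_sub hentropy hlogκ, integral_neg, ← integral_comp_measure hlog, ← hb,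
          integral_log_real_singleton]
        ring

theorem exists_measureReal_compl_singleton_le_entropy (b : Measure (Fin N))
    [IsProbabilityMeasure b] : ∃ c, b.real {c}ᶜ ≤ entropy b := by
  have := nonempty_of_isProbabilityMeasure b
  obtain ⟨c, hc⟩ := Finite.exists_max fun c => b.real {c}
  have hterm : ∀ i, b.real {i} * (1 - b.real {c}) ≤ Real.negMulLog (b.real {i}) := fun i => by
    rcases (measureReal_nonneg (μ := b) (s := {i})).eq_or_lt with h0 | h0
    · simp only [← h0, zero_mul, Real.negMulLog_zero, le_refl]
    · have hlog : 1 - b.real {c} ≤ -Real.log (b.real {i}) := by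
        linarith [Real.log_le_sub_one_of_pos h0, hc i]
      rw [Real.negMulLog, neg_mul_comm]
      gcongr
  refine ⟨c, ?_⟩
  calc b.real {c}ᶜ = 1 - b.real {c} := probReal_compl_eq_one_sub (measurableSet_singleton c)
    _ = ∑ i, b.real {i} * (1 - b.real {c}) := by
        rw [← Finset.sum_mul, sum_real_singleton_eq_one, one_mul]
    _ ≤ entropy b := Finset.sum_le_sum fun i _ => hterm i

end Entropy

section Bayes

variable {Ω α β γ : Type*} [MeasurableSpace Ω] [MeasurableSpace α] [MeasurableSpace β]
  [MeasurableSpace γ] {P : Measure Ω} [IsFiniteMeasure P]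
  {C : Ω → γ} {X : Ω → α} {Y : Ω → β} {κ : Kernel (γ × α) β}

theorem map_prodMap_compProd_comap {μ : Measure α} [SFinite μ] {κ : Kernel β γ}
    [IsSFiniteKernel κ] {f : α → β} (hf : Measurable f) :
    (μ ⊗ₘ κ.comap f hf).map (Prod.map f id) = μ.map f ⊗ₘ κ := by
  have hfid : Measurable (Prod.map f (id : γ → γ)) := hf.prodMap measurable_id
  ext s hs
  rw [Measure.map_apply hfid hs, Measure.compProd_apply (hfid hs), Measure.compProd_apply hs,
    lintegral_map (Kernel.measurable_kernel_prodMk_left hs) hf]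
  rfl

theorem condDistrib_measurableEquiv_comp [StandardBorelSpace γ] [Nonempty γ] (e : α ≃ᵐ β)
    (hC : Measurable C) (hX : Measurable X) :
    ∀ᵐ ω ∂P, condDistrib C X P (X ω) = condDistrib C (e ∘ X) P (e (X ω)) := by
  have hmap : P.map (fun ω => (X ω, C ω)) =
      P.map X ⊗ₘ (condDistrib C (e ∘ X) P).comap e e.measurable := by
    refine MeasurableEquiv.map_measurableEquiv_injective (e.prodCongr (MeasurableEquiv.refl γ)) ?_
    change _ = (P.map X ⊗ₘ _).map (Prod.map e id)
    rw [map_prodMap_compProd_comap, Measure.map_map e.measurable hX,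
      compProd_map_condDistrib hC.aemeasurable, Measure.map_map (by fun_prop) (by fun_prop)]
    rfl
  exact ae_of_ae_map hX.aemeasurable
    (condDistrib_ae_eq_of_measure_eq_compProd X hC.aemeasurable hmap)

variable [IsMarkovKernel κ]

theorem map_compProd_condDistrib_swapLeft [StandardBorelSpace γ] [Nonempty γ]
    (hC : Measurable C) (hX : Measurable X) (hY : Measurable Y)
    (hκ : P.map (fun ω => ((C ω, X ω), Y ω)) = P.map (fun ω => (C ω, X ω)) ⊗ₘ κ) :
    P.map X ⊗ₘ (condDistrib C X P ⊗ₖ κ.swapLeft) = P.map fun ω => (X ω, C ω, Y ω) := by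
  have hswap : P.map (fun ω => ((X ω, C ω), Y ω)) =
      P.map (fun ω => (X ω, C ω)) ⊗ₘ κ.swapLeft := by
    have h := map_prodMap_compProd_comap (μ := P.map fun ω => (C ω, X ω)) (κ := κ.swapLeft)
      measurable_swap
    change (_ ⊗ₘ κ).map _ = _ at h
    rw [← hκ, Measure.map_map (by fun_prop) (by fun_prop),
      Measure.map_map (by fun_prop) (by fun_prop)] at h
    exact h
  rw [← Measure.compProd_assoc', compProd_map_condDistrib hC.aemeasurable, ← hswap,
    Measure.map_map (by fun_prop) (by fun_prop)]
  rfl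

theorem map_compProd_snd_condDistrib_swapLeft [StandardBorelSpace γ] [Nonempty γ]
    (hC : Measurable C) (hX : Measurable X) (hY : Measurable Y)
    (hκ : P.map (fun ω => ((C ω, X ω), Y ω)) = P.map (fun ω => (C ω, X ω)) ⊗ₘ κ) :
    P.map X ⊗ₘ (condDistrib C X P ⊗ₖ κ.swapLeft).snd = P.map fun ω => (X ω, Y ω) := by
  rw [Kernel.snd_eq, Measure.compProd_map measurable_snd,
    map_compProd_condDistrib_swapLeft hC hX hY hκ, Measure.map_map (by fun_prop) (by fun_prop)]
  rfl

theorem ae_map_swap_compProd_sectL_eq [StandardBorelSpace γ] [Nonempty γ]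
    [MeasurableSpace.CountablyGenerated β]
    (hC : Measurable C) (hX : Measurable X) (hY : Measurable Y)
    (hκ : P.map (fun ω => ((C ω, X ω), Y ω)) = P.map (fun ω => (C ω, X ω)) ⊗ₘ κ) :
    ∀ᵐ x ∂P.map X, (condDistrib C X P x ⊗ₘ κ.sectL x).map Prod.swap =
      (condDistrib C X P ⊗ₖ κ.swapLeft).snd x ⊗ₘ
        (condDistrib C (fun ω => (X ω, Y ω)) P).sectR x := by
  set b := condDistrib C X P
  have := Kernel.IsMarkovKernel.map (b ⊗ₖ κ.swapLeft) measurable_swap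
  have heq : P.map X ⊗ₘ (b ⊗ₖ κ.swapLeft).map Prod.swap =
      P.map X ⊗ₘ ((b ⊗ₖ κ.swapLeft).snd ⊗ₖ condDistrib C (fun ω => (X ω, Y ω)) P) := by
    rw [Measure.compProd_map measurable_swap, map_compProd_condDistrib_swapLeft hC hX hY hκ,
      ← Measure.compProd_assoc', map_compProd_snd_condDistrib_swapLeft hC hX hY hκ,
      compProd_map_condDistrib hC.aemeasurable,
      Measure.map_map (by fun_prop) (by fun_prop), Measure.map_map (by fun_prop) (by fun_prop)]
    rfl
  filter_upwards [Kernel.ae_eq_of_compProd_eq heq] with x hx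
  rwa [Kernel.map_apply _ measurable_swap, Kernel.compProd_apply_eq_compProd_sectR,
    Kernel.compProd_apply_eq_compProd_sectR, Kernel.sectR_swapRight] at hx

end Bayes

section ChainRule

variable {N : ℕ} {Ω α β : Type*} [MeasurableSpace Ω] [MeasurableSpace α] [MeasurableSpace β]

theorem mutualInfo_compProd_of_map_swap_eq {b : Measure (Fin N)} [IsProbabilityMeasure b]
    {κ : Kernel (Fin N) β} [IsMarkovKernel κ] {m : Measure β} [IsProbabilityMeasure m]
    {q : Kernel β (Fin N)} [IsMarkovKernel q] (h : (b ⊗ₘ κ).map Prod.swap = m ⊗ₘ q) :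
    mutualInfo (b ⊗ₘ κ) = entropy b - ∫ y, entropy (q y) ∂m := by
  have hb : q ∘ₘ m = b := by
    rw [← Measure.snd_compProd, ← h, Measure.snd_map_swap, Measure.fst_compProd]
  rw [← mutualInfo_map_swap, h, mutualInfo_compProd, hb]

variable [NeZero N] {P : Measure Ω} [IsProbabilityMeasure P] {C : Ω → Fin N} {X : Ω → α}
  {Y : Ω → β}

theorem integrable_entropy_condDistrib (hX : Measurable X) :
    Integrable (fun ω => entropy (condDistrib C X P (X ω))) P :=
  (integrable_entropy (condDistrib C X P) (P.map X)).comp_measurable hX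

variable [MeasurableSpace.CountablyGenerated β] {κ : Kernel (Fin N × α) β} [IsMarkovKernel κ]
  (hC : Measurable C) (hX : Measurable X) (hY : Measurable Y)
  (hκ : P.map (fun ω => ((C ω, X ω), Y ω)) = P.map (fun ω => (C ω, X ω)) ⊗ₘ κ)
include hC hX hY hκ

theorem ae_mutualInfo_compProd_sectL_eq :
    ∀ᵐ ω ∂P, mutualInfo (condDistrib C X P (X ω) ⊗ₘ κ.sectL (X ω)) =
      entropy (condDistrib C X P (X ω)) -
        ∫ y, entropy (condDistrib C (fun ω => (X ω, Y ω)) P (X ω, y))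
          ∂(condDistrib C X P ⊗ₖ κ.swapLeft).snd (X ω) := by
  filter_upwards [ae_of_ae_map hX.aemeasurable (ae_map_swap_compProd_sectL_eq hC hX hY hκ)]
    with ω hω
  rw [mutualInfo_compProd_of_map_swap_eq hω]
  simp only [Kernel.sectR_apply]

theorem integrable_mutualInfo_compProd_sectL :
    Integrable (fun ω => mutualInfo (condDistrib C X P (X ω) ⊗ₘ κ.sectL (X ω))) P :=
  ((integrable_entropy_condDistrib hX).sub
    ((integrable_integral_compProd (integrable_entropy (condDistrib C (fun ω => (X ω, Y ω)) P)
      (P.map X ⊗ₘ (condDistrib C X P ⊗ₖ κ.swapLeft).snd))).comp_measurable hX)).congr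
    ((ae_mutualInfo_compProd_sectL_eq hC hX hY hκ).mono fun _ h => h.symm)

theorem integral_mutualInfo_compProd_sectL :
    ∫ ω, mutualInfo (condDistrib C X P (X ω) ⊗ₘ κ.sectL (X ω)) ∂P =
      ∫ ω, entropy (condDistrib C X P (X ω)) ∂P -
        ∫ ω, entropy (condDistrib C (fun ω => (X ω, Y ω)) P (X ω, Y ω)) ∂P := by
  have hq := integrable_entropy (condDistrib C (fun ω => (X ω, Y ω)) P)
    (P.map X ⊗ₘ (condDistrib C X P ⊗ₖ κ.swapLeft).snd)
  have hqX := integrable_integral_compProd hq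
  rw [integral_congr_ae (ae_mutualInfo_compProd_sectL_eq hC hX hY hκ)]
  refine (integral_sub (integrable_entropy_condDistrib hX) (hqX.comp_measurable hX)).trans
    (congrArg _ ?_)
  rw [← integral_map (hX.prodMk hY).aemeasurable (measurable_entropy _).aestronglyMeasurable,
    ← map_compProd_snd_condDistrib_swapLeft hC hX hY hκ, Measure.integral_compProd hq,
    integral_map hX.aemeasurable hqX.aestronglyMeasurable]
  rfl

end ChainRule

theorem integral_comp_eq_integral_integral_condDistrib {Ω α γ : Type*} [MeasurableSpace Ω]
    [MeasurableSpace α] [MeasurableSpace γ] [StandardBorelSpace γ] [Nonempty γ] {P : Measure Ω}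
    [IsFiniteMeasure P] {C : Ω → γ} {X : Ω → α} (hC : Measurable C) (hX : Measurable X)
    {f : α × γ → ℝ} (hf : StronglyMeasurable f) (hint : Integrable (fun ω => f (X ω, C ω)) P) :
    ∫ ω, f (X ω, C ω) ∂P = ∫ ω, ∫ c, f (X ω, c) ∂condDistrib C X P (X ω) ∂P := by
  rw [← integral_condExp hX.comap_le (f := fun ω => f (X ω, C ω))]
  exact integral_congr_ae (condExp_prod_ae_eq_integral_condDistrib hX hC.aemeasurable hf hint)

section Value

variable {N : ℕ} {S A O : Type*} [MeasurableSpace S] [MeasurableSpace A] [MeasurableSpace O]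
  (M : CPOMDP N S A O) {T : ℕ} {R τ : ℝ}

theorem measurable_sum_reward (T : ℕ) (c : Fin N) :
    Measurable fun x : Traj S A O T => ∑ t : Fin T, M.reward c (x.1 t.castSucc).1 (x.2 t) :=
  Finset.measurable_sum _ fun t _ => (M.reward_measurable c).comp
    (by fun_prop : Measurable fun x : Traj S A O T => ((x.1 t.castSucc).1, x.2 t))

theorem measurable_value {H : Type*} [MeasurableSpace H] {sel : H → Policy A O} {c : Fin N}
    (hsel : Measurable fun h => M.trajLaw c (sel h) T) :
    Measurable fun h => M.value T c (sel h) := by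
  let κ : Kernel H (Traj S A O T) := ⟨fun h => M.trajLaw c (sel h) T, hsel⟩
  have : IsMarkovKernel κ := ⟨fun h => inferInstanceAs (IsProbabilityMeasure (M.trajLaw _ _ _))⟩
  exact (StronglyMeasurable.integral_kernel (κ := κ)
    (measurable_sum_reward M T c).stronglyMeasurable).measurable

variable {M}

theorem abs_value_le (hR : ∀ c s a, |M.reward c s a| ≤ R) (c : Fin N) (π : Policy A O) :
    |M.value T c π| ≤ T * R := by
  have hsum : ∀ x : Traj S A O T,
      ‖∑ t : Fin T, M.reward c (x.1 t.castSucc).1 (x.2 t)‖ ≤ T * R := fun x =>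
    (norm_sum_le_of_le _ fun t _ => hR c _ _).trans (by simp)
  simpa only [value, Real.norm_eq_abs, probReal_univ, mul_one] using
    norm_integral_le_of_norm_le_const (μ := M.trajLaw c π T) (Filter.Eventually.of_forall hsum)

theorem abs_value_sub_le (hR : ∀ c s a, |M.reward c s a| ≤ R) (c : Fin N) (π π' : Policy A O) :
    |M.value T c π - M.value T c π'| ≤ 2 * (T * R) := by
  linarith [abs_sub (M.value T c π) (M.value T c π'), abs_value_le (T := T) hR c π,
    abs_value_le (T := T) hR c π']

theorem integral_value_sub_le (hR : ∀ c s a, |M.reward c s a| ≤ R) (b : Measure (Fin N))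
    [IsFiniteMeasure b] (πstar : Fin N → Policy A O) (i : Fin N) :
    ∫ c, (M.value T c (πstar c) - M.value T c (πstar i)) ∂b ≤ 2 * (T * R) * b.real {i}ᶜ := by
  rw [← integral_add_compl (measurableSet_singleton i) Integrable.of_finite, integral_singleton,
    sub_self, smul_zero, zero_add]
  exact (Real.le_norm_self _).trans <| norm_setIntegral_le_of_norm_le_const (measure_lt_top b _)
    fun c _ => abs_value_sub_le hR c _ _

theorem expectedValue_sub_le_of_isMaxOn (hτ : 0 ≤ τ) {b : Measure (Fin N)} {Pol : Set (Policy A O)}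
    {π π' : Policy A O} (hπ' : π' ∈ Pol)
    (hπ : IsMaxOn (fun π => M.expectedValue T b π + τ * M.infoGain T b π) Pol π) :
    M.expectedValue T b π' - M.expectedValue T b π ≤ τ * M.infoGain T b π := by
  have hmax : M.expectedValue T b π' + τ * M.infoGain T b π' ≤
      M.expectedValue T b π + τ * M.infoGain T b π := hπ hπ'
  have hinfo : 0 ≤ τ * M.infoGain T b π' := mul_nonneg hτ ENNReal.toReal_nonneg
  linarith

theorem integral_value_sub_le_of_isMaxOn (hR : ∀ c s a, |M.reward c s a| ≤ R) (hτ : 0 ≤ τ)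
    {b : Measure (Fin N)} [IsProbabilityMeasure b] {Pol : Set (Policy A O)}
    {πstar : Fin N → Policy A O} (hstar : ∀ c, πstar c ∈ Pol) {π : Policy A O}
    (hπ : IsMaxOn (fun π => M.expectedValue T b π + τ * M.infoGain T b π) Pol π) :
    ∫ c, (M.value T c (πstar c) - M.value T c π) ∂b ≤
      2 * (T * R) * min 1 (entropy b) + τ * M.infoGain T b π := by
  obtain ⟨i, hi⟩ := exists_measureReal_compl_singleton_le_entropy b
  have hTR : 0 ≤ 2 * (T * R) := (abs_nonneg _).trans (abs_value_sub_le hR i π π)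
  calc ∫ c, (M.value T c (πstar c) - M.value T c π) ∂b
      = ∫ c, (M.value T c (πstar c) - M.value T c (πstar i)) ∂b +
          (M.expectedValue T b (πstar i) - M.expectedValue T b π) := by
        simp only [expectedValue, integral_sub Integrable.of_finite Integrable.of_finite]
        ring
    _ ≤ 2 * (T * R) * b.real {i}ᶜ + τ * M.infoGain T b π :=
        add_le_add (integral_value_sub_le hR b πstar i)
          (expectedValue_sub_le_of_isMaxOn hτ (hstar i) hπ)
    _ ≤ 2 * (T * R) * min 1 (entropy b) + τ * M.infoGain T b π := by
        gcongr
        exact le_min measureReal_le_one hi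

end Value

theorem sum_min_one_le_sqrt {ι : Type*} (s : Finset ι) {h : ι → ℝ} (hh : ∀ i ∈ s, 0 ≤ h i) :
    ∑ i ∈ s, min 1 (h i) ≤ √(s.card * ∑ i ∈ s, h i) := by
  have hcard : ∑ i ∈ s, min 1 (h i) ≤ s.card := by
    simpa only [Finset.sum_const, nsmul_eq_mul, mul_one] using
      Finset.sum_le_sum fun i (_ : i ∈ s) => min_le_left 1 (h i)
  have hsum : ∑ i ∈ s, min 1 (h i) ≤ ∑ i ∈ s, h i :=
    Finset.sum_le_sum fun i _ => min_le_right 1 (h i)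
  have hnonneg : 0 ≤ ∑ i ∈ s, min 1 (h i) :=
    Finset.sum_nonneg fun i hi => le_min zero_le_one (hh i hi)
  refine Real.le_sqrt_of_sq_le ?_
  rw [sq]
  gcongr

theorem mul_le_mul_sqrt_div {τ D K H η : ℝ} (hD : 0 ≤ D) (hK : 0 ≤ K) (hH : 0 ≤ H) (hη : 0 < η)
    (hη₁ : η ≤ 1) (h : τ ^ 2 * H ≤ K * D ^ 2) : τ * H ≤ D * √(K * H / η) :=
  calc τ * H ≤ √(D ^ 2 * (K * H)) := Real.le_sqrt_of_sq_le (by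
        linarith [mul_le_mul_of_nonneg_right h hH])
    _ = D * √(K * H) := by rw [Real.sqrt_mul (sq_nonneg D), Real.sqrt_sq hD]
    _ ≤ D * √(K * H / η) := by
        gcongr
        exact le_div_self (mul_nonneg hK hH) hη hη₁

namespace Interaction

variable {N : ℕ} {S A O Ω : Type*} [MeasurableSpace S] [MeasurableSpace A]
  [MeasurableSpace O] [MeasurableSpace Ω] {M : CPOMDP N S A O} {T K : ℕ}
  {prior : Measure (Fin N)} {P : Measure Ω} (X : Interaction M T K prior P) {R τ η : ℝ}
  {Pol : Set (Policy A O)} {πstar : Fin N → Policy A O}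

theorem measurable_hist (k : ℕ) : Measurable (X.hist k) :=
  measurable_pi_lambda _ fun i => X.obs_measurable i

instance isMarkovKernel_episodeKernel (k : ℕ) :
    IsMarkovKernel (M.episodeKernel T (X.sel k) (X.sel_measurable k)) :=
  ⟨fun p => Measure.isProbabilityMeasure_map (μ := M.trajLaw p.1 (X.sel k p.2) T)
    measurable_observed.aemeasurable⟩

theorem measurable_value_sub_value_sel (πstar : Fin N → Policy A O) (k : ℕ) :
    Measurable fun p : (Fin k → ObsTraj A O T) × Fin N =>
      M.value T p.2 (πstar p.2) - M.value T p.2 (X.sel k p.1) :=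
  measurable_from_prod_countable_left fun c =>
    (measurable_value M (X.sel_measurable k c)).const_sub (M.value T c (πstar c))

theorem regret_eq_zero (hR : ∀ c s a, |M.reward c s a| ≤ R) (hTR : T * R = 0)
    (πstar : Fin N → Policy A O) (ω : Ω) : X.regret πstar ω = 0 :=
  Finset.sum_eq_zero fun _ _ => abs_nonpos_iff.1 <|
    (abs_value_sub_le hR _ _ _).trans_eq (by rw [hTR, mul_zero])

variable [IsProbabilityMeasure P]

include X in
theorem isProbabilityMeasure_prior : IsProbabilityMeasure prior :=
  X.ctx_law ▸ Measure.isProbabilityMeasure_map X.ctx_measurable.aemeasurable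

theorem integrable_value_sub_value_policy (hR : ∀ c s a, |M.reward c s a| ≤ R)
    (πstar : Fin N → Policy A O) (k : ℕ) :
    Integrable (fun ω => M.value T (X.ctx ω) (πstar (X.ctx ω)) -
      M.value T (X.ctx ω) (X.policy k ω)) P :=
  .of_bound ((X.measurable_value_sub_value_sel πstar k).comp
    ((X.measurable_hist k).prodMk X.ctx_measurable)).aestronglyMeasurable (2 * (T * R))
    (Filter.Eventually.of_forall fun _ => abs_value_sub_le hR _ _ _)

theorem integrable_regret (hR : ∀ c s a, |M.reward c s a| ≤ R) (πstar : Fin N → Policy A O) :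
    Integrable (X.regret πstar) P :=
  integrable_finsetSum _ fun k _ => X.integrable_value_sub_value_policy hR πstar k

variable [NeZero N]

instance isProbabilityMeasure_posterior (k : ℕ) (ω : Ω) :
    IsProbabilityMeasure (X.posterior k ω) := by
  unfold posterior
  infer_instance

theorem posterior_zero (ω : Ω) : X.posterior 0 ω = prior := by
  have hconst : X.hist 0 = fun _ => X.hist 0 ω := funext fun _ => Subsingleton.elim _ _
  have hlaw := condDistrib_comp_map (μ := P) (X.measurable_hist 0).aemeasurable
    X.ctx_measurable.aemeasurable
  have hdirac : P.map (X.hist 0) = Measure.dirac (X.hist 0 ω) := by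
    conv_lhs => rw [hconst]
    rw [Measure.map_const, measure_univ, one_smul]
  rwa [hdirac, Measure.dirac_bind (Kernel.measurable _), X.ctx_law] at hlaw

theorem condEntropy_zero : X.condEntropy 0 = entropy prior := by
  simp only [condEntropy, posterior_zero, integral_const, probReal_univ, one_smul]

theorem condEntropy_nonneg (k : ℕ) : 0 ≤ X.condEntropy k :=
  integral_nonneg fun _ => entropy_nonneg _

theorem integrable_entropy_posterior (k : ℕ) :
    Integrable (fun ω => entropy (X.posterior k ω)) P :=
  integrable_entropy_condDistrib (X.measurable_hist k)

theorem integral_value_sub_value_policy (hR : ∀ c s a, |M.reward c s a| ≤ R)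
    (πstar : Fin N → Policy A O) (k : ℕ) :
    ∫ ω, (M.value T (X.ctx ω) (πstar (X.ctx ω)) - M.value T (X.ctx ω) (X.policy k ω)) ∂P =
      ∫ ω, ∫ c, (M.value T c (πstar c) - M.value T c (X.policy k ω)) ∂X.posterior k ω ∂P :=
  integral_comp_eq_integral_integral_condDistrib X.ctx_measurable (X.measurable_hist k)
    (X.measurable_value_sub_value_sel πstar k).stronglyMeasurable
    (X.integrable_value_sub_value_policy hR πstar k)

theorem integrable_integral_value_sub_posterior (hR : ∀ c s a, |M.reward c s a| ≤ R)
    (πstar : Fin N → Policy A O) (k : ℕ) :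
    Integrable (fun ω => ∫ c, (M.value T c (πstar c) - M.value T c (X.policy k ω))
      ∂X.posterior k ω) P :=
  Integrable.integral_condDistrib (X.measurable_hist k).aemeasurable X.ctx_measurable.aemeasurable
    ((integrable_map_measure (X.measurable_value_sub_value_sel πstar k).aestronglyMeasurable
      ((X.measurable_hist k).prodMk X.ctx_measurable).aemeasurable).2
      (X.integrable_value_sub_value_policy hR πstar k))

theorem integrable_min_one_entropy_posterior (k : ℕ) :
    Integrable (fun ω => min 1 (entropy (X.posterior k ω))) P :=
  (integrable_const 1).inf (X.integrable_entropy_posterior k)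

theorem integral_min_one_entropy_posterior_le (k : ℕ) :
    ∫ ω, min 1 (entropy (X.posterior k ω)) ∂P ≤ min 1 (X.condEntropy k) := by
  have hmin := X.integrable_min_one_entropy_posterior k
  refine le_min ?_ (integral_mono hmin (X.integrable_entropy_posterior k) fun _ => min_le_right _ _)
  simpa only [integral_const, probReal_univ, one_smul] using
    integral_mono hmin (integrable_const 1) fun _ => min_le_left _ _

theorem ae_posterior_succ_eq (k : ℕ) :
    ∀ᵐ ω ∂P, X.posterior (k + 1) ω =
      condDistrib X.ctx (fun ω => (X.hist k ω, X.obs k ω)) P (X.hist k ω, X.obs k ω) := by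
  let e := (MeasurableEquiv.piFinSuccAbove (fun _ => ObsTraj A O T) (Fin.last k)).trans
    MeasurableEquiv.prodComm
  have he : ∀ ω, e (X.hist (k + 1) ω) = (X.hist k ω, X.obs k ω) := fun ω => by
    refine Prod.ext (funext fun i => ?_) rfl
    exact congrArg (fun j : Fin (k + 1) => X.obs j ω) (Fin.succAbove_last_apply i)
  filter_upwards [condDistrib_measurableEquiv_comp (P := P) e X.ctx_measurable
    (X.measurable_hist (k + 1))] with ω hω
  rw [posterior, hω, he]
  congr 2
  exact funext he

variable [MeasurableSpace.CountablyGenerated A] [MeasurableSpace.CountablyGenerated O]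

theorem integrable_infoGain {k : ℕ} (hk : k < K) :
    Integrable (fun ω => M.infoGain T (X.posterior k ω) (X.policy k ω)) P := by
  have hint := integrable_mutualInfo_compProd_sectL X.ctx_measurable (X.measurable_hist k)
    (X.obs_measurable k) (X.obs_law k hk)
  exact hint

theorem condMutualInfo_eq {k : ℕ} (hk : k < K) :
    X.condMutualInfo k = X.condEntropy k - X.condEntropy (k + 1) := by
  have hchain := integral_mutualInfo_compProd_sectL X.ctx_measurable (X.measurable_hist k)
    (X.obs_measurable k) (X.obs_law k hk)
  refine hchain.trans (congrArg _ (integral_congr_ae ?_))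
  filter_upwards [X.ae_posterior_succ_eq k] with ω hω
  rw [hω]

theorem sum_condMutualInfo_le : ∑ k ∈ Finset.range K, X.condMutualInfo k ≤ entropy prior :=
  calc ∑ k ∈ Finset.range K, X.condMutualInfo k
      = ∑ k ∈ Finset.range K, (X.condEntropy k - X.condEntropy (k + 1)) :=
        Finset.sum_congr rfl fun k hk => X.condMutualInfo_eq (Finset.mem_range.1 hk)
    _ = entropy prior - X.condEntropy K := by
        rw [Finset.sum_range_sub', X.condEntropy_zero]
    _ ≤ entropy prior := sub_le_self _ (X.condEntropy_nonneg K)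

variable {X}

theorem IsInfoConstant.sum_condEntropy_le (hη : X.IsInfoConstant η) :
    ∑ k ∈ Finset.range K, X.condEntropy k ≤ entropy prior / η :=
  calc ∑ k ∈ Finset.range K, X.condEntropy k
      ≤ ∑ k ∈ Finset.range K, 1 / η * X.condMutualInfo k :=
        Finset.sum_le_sum fun k hk => hη.2 k (Finset.mem_range.1 hk)
    _ = (∑ k ∈ Finset.range K, X.condMutualInfo k) / η := by
        rw [← Finset.mul_sum, one_div_mul_eq_div]
    _ ≤ entropy prior / η := div_le_div_of_nonneg_right X.sum_condMutualInfo_le hη.1.le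

theorem IsInfoConstant.le_one (hη : X.IsInfoConstant η) (hK : 0 < K)
    (hprior : 0 < entropy prior) : η ≤ 1 := by
  have hinfo : X.condMutualInfo 0 ≤ entropy prior := by
    rw [X.condMutualInfo_eq hK, X.condEntropy_zero]
    exact sub_le_self _ (X.condEntropy_nonneg _)
  have hη₀ : entropy prior ≤ 1 / η * X.condMutualInfo 0 := X.condEntropy_zero ▸ hη.2 0 hK
  rw [one_div_mul_eq_div, le_div_iff₀ hη.1] at hη₀
  exact le_of_mul_le_mul_left (by linarith) hprior

theorem IsCIDS.integral_value_sub_value_policy_le (hX : X.IsCIDS Pol τ)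
    (hR : ∀ c s a, |M.reward c s a| ≤ R) (hτ : 0 ≤ τ) (hstar : ∀ c, πstar c ∈ Pol) {k : ℕ}
    (hk : k < K) :
    ∫ ω, (M.value T (X.ctx ω) (πstar (X.ctx ω)) - M.value T (X.ctx ω) (X.policy k ω)) ∂P ≤
      2 * (T * R) * min 1 (X.condEntropy k) + τ * X.condMutualInfo k := by
  have hTR : 0 ≤ 2 * (T * R) := (abs_nonneg _).trans (abs_value_sub_le hR 0 (πstar 0) (πstar 0))
  have hmin := (X.integrable_min_one_entropy_posterior k).const_mul (2 * (T * R))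
  have hinfo := (X.integrable_infoGain hk).const_mul τ
  calc ∫ ω, (M.value T (X.ctx ω) (πstar (X.ctx ω)) - M.value T (X.ctx ω) (X.policy k ω)) ∂P
      = ∫ ω, ∫ c, (M.value T c (πstar c) - M.value T c (X.policy k ω)) ∂X.posterior k ω ∂P :=
        X.integral_value_sub_value_policy hR πstar k
    _ ≤ ∫ ω, (2 * (T * R) * min 1 (entropy (X.posterior k ω)) +
          τ * M.infoGain T (X.posterior k ω) (X.policy k ω)) ∂P := by
        refine integral_mono_ae (X.integrable_integral_value_sub_posterior hR πstar k)
          (hmin.add hinfo) ?_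
        filter_upwards [hX k hk] with ω hω using
          integral_value_sub_le_of_isMaxOn hR hτ hstar hω.2
    _ = 2 * (T * R) * ∫ ω, min 1 (entropy (X.posterior k ω)) ∂P + τ * X.condMutualInfo k := by
        rw [integral_add hmin hinfo, integral_const_mul, integral_const_mul, condMutualInfo]
    _ ≤ 2 * (T * R) * min 1 (X.condEntropy k) + τ * X.condMutualInfo k := by
        gcongr
        exact X.integral_min_one_entropy_posterior_le k

theorem IsCIDS.integral_regret_le (hX : X.IsCIDS Pol τ) (hR : ∀ c s a, |M.reward c s a| ≤ R)
    (hτ : 0 ≤ τ) (hstar : ∀ c, πstar c ∈ Pol) (hη : X.IsInfoConstant η) :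
    ∫ ω, X.regret πstar ω ∂P ≤ τ * entropy prior + 2 * (T * R) * √(K * entropy prior / η) := by
  have hTR : 0 ≤ 2 * (T * R) := (abs_nonneg _).trans (abs_value_sub_le hR 0 (πstar 0) (πstar 0))
  have hmin : ∑ k ∈ Finset.range K, min 1 (X.condEntropy k) ≤ √(K * entropy prior / η) := by
    refine (sum_min_one_le_sqrt _ fun k _ => X.condEntropy_nonneg k).trans ?_
    rw [Finset.card_range, mul_div_assoc]
    gcongr
    exact hη.sum_condEntropy_le
  calc ∫ ω, X.regret πstar ω ∂P
      = ∑ k ∈ Finset.range K, ∫ ω, (M.value T (X.ctx ω) (πstar (X.ctx ω)) -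
          M.value T (X.ctx ω) (X.policy k ω)) ∂P :=
        integral_finsetSum _ fun k _ => X.integrable_value_sub_value_policy hR πstar k
    _ ≤ ∑ k ∈ Finset.range K,
          (2 * (T * R) * min 1 (X.condEntropy k) + τ * X.condMutualInfo k) :=
        Finset.sum_le_sum fun k hk =>
          hX.integral_value_sub_value_policy_le hR hτ hstar (Finset.mem_range.1 hk)
    _ = τ * ∑ k ∈ Finset.range K, X.condMutualInfo k +
          2 * (T * R) * ∑ k ∈ Finset.range K, min 1 (X.condEntropy k) := by
        rw [Finset.sum_add_distrib, ← Finset.mul_sum, ← Finset.mul_sum, add_comm]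
    _ ≤ τ * entropy prior + 2 * (T * R) * √(K * entropy prior / η) := by
        gcongr
        exact X.sum_condMutualInfo_le

theorem IsCIDS.integral_regret_le_of_sq_mul_entropy_le (hX : X.IsCIDS Pol τ)
    (hR : ∀ c s a, |M.reward c s a| ≤ R) (hτ : 0 ≤ τ) (hstar : ∀ c, πstar c ∈ Pol)
    (hη : X.IsInfoConstant η) (hK : 0 < K) (hτK : τ ^ 2 * entropy prior ≤ K * (T * R) ^ 2) :
    ∫ ω, X.regret πstar ω ∂P ≤ 3 * (T * R * √(K * entropy prior / η)) := by
  have hTR : 0 ≤ T * R := (abs_nonneg _).trans (abs_value_le hR 0 (πstar 0))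
  have hprior : 0 ≤ entropy prior := X.condEntropy_zero ▸ X.condEntropy_nonneg 0
  have hτH : τ * entropy prior ≤ T * R * √(K * entropy prior / η) := by
    rcases hprior.eq_or_lt with h0 | h0
    · simp only [← h0, mul_zero, zero_div, Real.sqrt_zero, le_refl]
    · exact mul_le_mul_sqrt_div hTR K.cast_nonneg hprior hη.1 (hη.le_one hK h0) hτK
  linarith [hX.integral_regret_le hR hτ hstar hη]

end Interaction

end CPOMDP

theorem mainTheorem1_general (N : ℕ) [NeZero N] (T : ℕ) (Rmax : ℝ) {τ : ℝ} (hτ : 0 ≤ τ) :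
    ∃ K₀ : ℕ,
      ∀ (S : Type*) (A : Type*) (O : Type*) (Ω : Type*)
        [MeasurableSpace S] [MeasurableSpace A] [MeasurableSpace O] [MeasurableSpace Ω]
        [MeasurableSpace.CountablyGenerated A] [MeasurableSpace.CountablyGenerated O]
        (M : CPOMDP N S A O) (_ : ∀ c s a, |M.reward c s a| ≤ Rmax)
        (prior : Measure (Fin N)) (P : Measure Ω) [IsProbabilityMeasure P]
        (Pol : Set (CPOMDP.Policy A O)) (πstar : Fin N → CPOMDP.Policy A O)
        (_ : ∀ c, πstar c ∈ Pol)
        (K : ℕ) (X : CPOMDP.Interaction M T K prior P) (_ : X.IsCIDS Pol τ)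
        (η : ℝ) (_ : X.IsInfoConstant η),
        Integrable (X.regret πstar) P ∧
        ∫ ω, X.regret πstar ω ∂P ≤
          τ * Real.log N + 2 * T * Rmax * √(K * Real.log N / η) ∧
        (K₀ ≤ K → ∫ ω, X.regret πstar ω ∂P ≤ 3 * (T * Rmax * √(K * Real.log N / η))) := by
  obtain ⟨K₀, hK₀⟩ := exists_nat_ge (τ ^ 2 * Real.log N / (T * Rmax) ^ 2)
  refine ⟨K₀ + 1, fun S A O Ω _ _ _ _ _ _ M hR prior P _ Pol πstar hstar K X hX η hη => ?_⟩
  have := X.isProbabilityMeasure_prior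
  have hlog : CPOMDP.entropy prior ≤ Real.log N := CPOMDP.entropy_le_log prior
  have hTR₀ : 0 ≤ T * Rmax := (abs_nonneg _).trans (CPOMDP.abs_value_le hR 0 (πstar 0))
  have hη₀ := hη.1
  refine ⟨X.integrable_regret hR πstar, ?_, fun hK => ?_⟩
  · rw [mul_assoc 2]
    exact (hX.integral_regret_le hR hτ hstar hη).trans (by gcongr)
  rcases hTR₀.eq_or_lt with hTR | hTR
  · simp only [X.regret_eq_zero hR hTR.symm, integral_zero, ← hTR, zero_mul, mul_zero, le_refl]
  · rw [div_le_iff₀ (by positivity)] at hK₀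
    have hτK : τ ^ 2 * CPOMDP.entropy prior ≤ K * (T * Rmax) ^ 2 :=
      calc τ ^ 2 * CPOMDP.entropy prior ≤ τ ^ 2 * Real.log N := by gcongr
        _ ≤ K₀ * (T * Rmax) ^ 2 := hK₀
        _ ≤ K * (T * Rmax) ^ 2 := by
            gcongr
            omega
    exact (hX.integral_regret_le_of_sq_mul_entropy_le hR hτ hstar hη (by omega) hτK).trans
      (by gcongr)

theorem mainTheorem1 :
    ∃ ξ > (0 : ℝ), ∃ κ > (0 : ℝ),
      ∀ (N : ℕ) [NeZero N] (T : ℕ) (Rmax τ : ℝ), 0 < Rmax → 0 < τ →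
      ∃ K₀ : ℕ,
        ∀ (S : Type*) (A : Type*) (O : Type*) (Ω : Type*)
          [MeasurableSpace S] [MeasurableSpace A] [MeasurableSpace O] [MeasurableSpace Ω]
          [MeasurableSpace.CountablyGenerated A] [MeasurableSpace.CountablyGenerated O]
          (M : CPOMDP N S A O) (_ : ∀ c s a, |M.reward c s a| ≤ Rmax)
          (prior : Measure (Fin N)) (P : Measure Ω) [IsProbabilityMeasure P]
          (Pol : Set (CPOMDP.Policy A O)) (πstar : Fin N → CPOMDP.Policy A O)
          (_ : ∀ c, πstar c ∈ Pol ∧ IsMaxOn (M.value T c) Pol (πstar c))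
          (K : ℕ) (X : CPOMDP.Interaction M T K prior P) (_ : X.IsCIDS Pol τ)
          (η : ℝ) (_ : X.IsInfoConstant η),
          Integrable (X.regret πstar) P ∧
          ∫ ω, X.regret πstar ω ∂P ≤
            τ * Real.log N + ξ * T * Rmax * √(K * Real.log N / η) + 2 * T * Rmax * √(K * T) ∧
          (K₀ ≤ K → ∫ ω, X.regret πstar ω ∂P ≤ κ * (T * Rmax * √(K * Real.log N / η))) := by
  refine ⟨2, two_pos, 3, three_pos, fun N _ T Rmax τ hR hτ => ?_⟩
  obtain ⟨K₀, h⟩ := mainTheorem1_general N T Rmax hτ.le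
  refine ⟨K₀, fun S A O Ω _ _ _ _ _ _ M hM prior P _ Pol πstar hstar K X hX η hη => ?_⟩
  obtain ⟨hint, hle, hlarge⟩ := h S A O Ω M hM prior P Pol πstar (fun c => (hstar c).1) K X hX η hη
  exact ⟨hint, hle.trans (le_add_of_nonneg_right (by positivity)), hlarge⟩
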